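/- Let $[N]=\{1,\dots,N\}$. A 4-AP $n,n+d,n+2d,n+3d$ with $d\neq 0$ is symmetrically colored by a coloring if $n$ and $n+3d$ have the same color and $n+d$ and $n+2d$ have the same color. For a positive integer $N$ and $A\subset\mathbb Z/N\mathbb Z$, call $A$ $\eta$-Fourier uniform if $\bigl|\frac1N\sum_{n\in\mathbb Z/N\mathbb Z}1_A(n)e^{-2\pi i rn/N}\bigr|\le\eta$ for all $r\neq0$ in $\mathbb Z/N\mathbb Z$, and let $$\Lambda_4(1_A)=\frac1{N^2}\sum_{n,d\in\mathbb Z/N\mathbb Z}1_A(n)1_A(n+d)1_A(n+2d)1_A(n+3d).$$ For $0<\alpha<1$, let $\rho_4(\alpha)$ be the supremum of all real $\rho$ such that for every $\epsilon>0$ there exist $\eta>0$ and $N_0$ such that every $\eta$-Fourier uniform $A\subset\mathbb Z/N\mathbb Z$ with $N\ge N_0$ and $|A|\ge(\alpha-\epsilon)N$ satisfies $\Lambda_4(1_A)\ge\rho-\epsilon$. Theorem. Suppose that for every $N\ge1$ there is a coloring of $[N]$ with at most $N^{o(1)}$ colors (where $o(1)\to0$ as $N\to\infty$) and without symmetrically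 colored 4-APs. Then for every $C>0$ one has $\rho_4(\alpha)<\alpha^C$ for all sufficiently small $\alpha>0$. -/

import Mathlib

open Filter Topology

/-- The normalized Fourier transform on `ℤ/Nℤ`: the average over `n` of `f n * exp (-2πi r n / N)`
(Mathlib's `ZMod.dft` is the unnormalized sum). -/
noncomputable def fourierCoeffZMod {N : ℕ} [NeZero N] (f : ZMod N → ℂ) (r : ZMod N) : ℂ :=
  (N : ℂ)⁻¹ * ZMod.dft f r

/-- `A ⊆ ℤ/Nℤ` is `η`-Fourier uniform. -/
def IsFourierUniform {N : ℕ} [NeZero N] (η : ℝ) (A : Finset (ZMod N)) : Prop :=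
  ∀ r : ZMod N, r ≠ 0 → ‖fourierCoeffZMod ((A : Set (ZMod N)).indicator 1) r‖ ≤ η

/-- `Λ₄(f)`, the average of `f(n) f(n+d) f(n+2d) f(n+3d)` over all `n, d` in `ℤ/Nℤ`. -/
noncomputable def Lambda4 {N : ℕ} [NeZero N] (f : ZMod N → ℝ) : ℝ :=
  (∑ n : ZMod N, ∑ d : ZMod N, f n * f (n + d) * f (n + 2 * d) * f (n + 3 * d)) / (N : ℝ) ^ 2

/-- `ρ` is an asymptotic lower bound for the 4-AP density of Fourier uniform sets of density
at least `α`. -/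
def IsLowerBound4AP (α ρ : ℝ) : Prop :=
  ∀ ε : ℝ, 0 < ε → ∃ η : ℝ, 0 < η ∧ ∃ N₀ : ℕ, ∀ (N : ℕ) [NeZero N], N₀ ≤ N →
    ∀ A : Finset (ZMod N), IsFourierUniform η A → (α - ε) * (N : ℝ) ≤ (A.card : ℝ) →
      ρ - ε ≤ Lambda4 ((A : Set (ZMod N)).indicator 1)

/-- `ρ₄(α)`, the minimum 4-AP density in a Fourier uniform set of density `α`. -/
noncomputable def rho4 (α : ℝ) : ℝ :=
  sSup {ρ : ℝ | IsLowerBound4AP α ρ}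

/-- The supremum defining `rho4` is over a nonempty set. -/
theorem isLowerBound4AP_zero (α : ℝ) : IsLowerBound4AP α 0 := by
  intro ε hε
  refine ⟨1, one_pos, 0, fun N _ _ A _ _ => ?_⟩
  have h : ∀ x : ZMod N, 0 ≤ (A : Set (ZMod N)).indicator (1 : ZMod N → ℝ) x :=
    fun x => Set.indicator_nonneg (fun _ _ => zero_le_one) x
  have : 0 ≤ Lambda4 ((A : Set (ZMod N)).indicator 1) :=
    div_nonneg (Finset.sum_nonneg fun n _ => Finset.sum_nonneg fun d _ =>
      mul_nonneg (mul_nonneg (mul_nonneg (h _) (h _)) (h _)) (h _)) (by positivity)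
  linarith

/-- The supremum defining `rho4 α` is over a set bounded above by `1`, when `α ≤ 1`. -/
theorem IsLowerBound4AP.le_one {α ρ : ℝ} (hα : α ≤ 1) (h : IsLowerBound4AP α ρ) : ρ ≤ 1 := by
  refine le_of_forall_pos_le_add fun ε hε => ?_
  obtain ⟨η, hη, N₀, H⟩ := h ε hε
  have hN : ((N₀ + 1 : ℕ) : ℝ) ≠ 0 := by positivity
  have key := H (N₀ + 1) (Nat.le_succ _) Finset.univ ?_ ?_
  · have h1 : Lambda4 (((Finset.univ : Finset (ZMod (N₀ + 1))) : Set (ZMod (N₀ + 1))).indicator 1)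
        = 1 := by
      simp only [Lambda4, Finset.coe_univ, Set.indicator_univ, Pi.one_apply, mul_one,
        Finset.sum_const, Finset.card_univ, ZMod.card, nsmul_eq_mul]
      field_simp
    linarith
  · intro r hr
    have h0 : ZMod.dft (1 : ZMod (N₀ + 1) → ℂ) r = 0 := by
      simp only [ZMod.dft_apply, Pi.one_apply, smul_eq_mul, mul_one]
      have := AddChar.sum_mulShift (-r) (ZMod.isPrimitive_stdAddChar (N₀ + 1))
      simpa [hr] using this
    simp [fourierCoeffZMod, h0, hη.le]
  · rw [Finset.card_univ, ZMod.card]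
    nlinarith [show (0 : ℝ) ≤ ((N₀ + 1 : ℕ) : ℝ) by positivity]

/-- The coloring `c` has no symmetrically colored 4-AP inside the set `S` of integers. -/
def AvoidsSymmetric4AP {κ : Type*} (S : Set ℤ) (c : ℤ → κ) : Prop :=
  ∀ n d : ℤ, d ≠ 0 → n ∈ S → n + d ∈ S → n + 2 * d ∈ S → n + 3 * d ∈ S →
    ¬ (c n = c (n + 3 * d) ∧ c (n + d) = c (n + 2 * d))

/-- There is a coloring of `[N] = {1, …, N}` with `r` colors and no symmetrically colored 4-AP
(only the values of `c` on `[N]` matter). -/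
def HasSymmetric4APFreeColoring (N r : ℕ) : Prop :=
  ∃ c : ℤ → Fin r, AvoidsSymmetric4AP (Set.Icc (1 : ℤ) (N : ℤ)) c

/-- For all `N ≥ 1` there is an `N ^ o(1)`-coloring of `[N]` without symmetrically colored
4-APs. -/
def Symmetric4APColoringConjecture : Prop :=
  ∃ e : ℕ → ℝ, Tendsto e atTop (𝓝 0) ∧
    ∀ N : ℕ, 1 ≤ N → ∃ r : ℕ, (r : ℝ) ≤ (N : ℝ) ^ e N ∧ HasSymmetric4APFreeColoring N r

/-! Take `q = 4w`, a large prime `p`, and identify `ℤ/pqℤ` with `ℤ/pℤ × ℤ/qℤ`. Let `A` consist of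
the pairs `(x, y)` with `x²` in an interval of length `s ≈ p/K` starting at `T y`. Squares are
equidistributed in intervals even against additive characters, so `A` is Fourier uniform of density
about `1/K`, whatever `T` is (`norm_sum_quadraticSet_sub_le`).

Since `x² - 3(x+d)² + 3(x+2d)² - (x+3d)² = 0`, a 4-AP in `A` nearly forces the same relation on the
four values of `T`. With `T = 4sg` and gaps this wide, it holds exactly for `g`
(`sub_eq_zero_of_val_lt`). Taking `g` to be a moment-curve code of the color makes the relation
trivial, so the `y`-progression is symmetrically colored (`momentCode_eq_of_sub_eq`). The coloring
then makes it constant, and only a proportion `1/q` of the differences survives.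

The code costs `K = O(r⁷)` for `r` colors. As `r` is subpolynomial in `q`, one can take `q` of order
`α^(-C)` while keeping `1/K ≥ α`. -/

/-! ### Equidistribution of squares modulo a prime. -/

/-- Quadratic Gauss sums with a linear phase have norm `√p`. -/
theorem norm_sq_sum_addChar_mul_stdAddChar_sq {p : ℕ} [Fact p.Prime] (hp : p ≠ 2)
    (χ : AddChar (ZMod p) ℂ) {k : ZMod p} (hk : k ≠ 0) :
    ‖∑ x : ZMod p, χ x * ZMod.stdAddChar (k * x ^ 2)‖ ^ 2 = p := by
  have h2 : (2 : ZMod p) ≠ 0 := Ring.two_ne_zero (by rwa [ZMod.ringChar_zmod_n])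
  have key : starRingEnd ℂ (∑ x : ZMod p, χ x * ZMod.stdAddChar (k * x ^ 2)) *
      ∑ x : ZMod p, χ x * ZMod.stdAddChar (k * x ^ 2) = p := by
    have shift : ∀ x : ZMod p, ∑ y : ZMod p, χ y * ZMod.stdAddChar (k * y ^ 2) =
        ∑ d : ZMod p, χ (x + d) * ZMod.stdAddChar (k * (x + d) ^ 2) := fun x =>
      (Equiv.sum_comp (Equiv.addLeft x) fun y => χ y * ZMod.stdAddChar (k * y ^ 2)).symm
    -- Differencing cancels `x²` and leaves a character linear in `x`, whose sum vanishes unless `d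
    -- = 0`.
    have term : ∀ x d : ZMod p, starRingEnd ℂ (χ x * ZMod.stdAddChar (k * x ^ 2)) *
        (χ (x + d) * ZMod.stdAddChar (k * (x + d) ^ 2)) =
        χ d * ZMod.stdAddChar (k * d ^ 2) * ZMod.stdAddChar (x * (2 * k * d)) := fun x d => by
      rw [map_mul, ← AddChar.map_neg_eq_conj, ← AddChar.map_neg_eq_conj, mul_mul_mul_comm,
        ← AddChar.map_add_eq_mul, ← AddChar.map_add_eq_mul, mul_assoc, ← AddChar.map_add_eq_mul]
      ring_nf
    rw [map_sum, Finset.sum_mul]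
    rw [Finset.sum_congr rfl fun x _ => by
      rw [shift x, Finset.mul_sum, Finset.sum_congr rfl fun d _ => term x d]]
    rw [Finset.sum_comm]
    simp only [← Finset.mul_sum, AddChar.sum_mulShift _ (ZMod.isPrimitive_stdAddChar p)]
    rw [Finset.sum_eq_single_of_mem 0 (Finset.mem_univ _)]
    · simp
    · intro d _ hd
      simp [h2, hk, hd]
  rw [Complex.conj_mul'] at key
  exact_mod_cast key

/-- The second moment of the exponential sums over an initial interval. -/
theorem sum_norm_sq_sum_range_stdAddChar {p : ℕ} [NeZero p] {s : ℕ} (hs : s ≤ p) :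
    ∑ k : ZMod p, ‖∑ i ∈ Finset.range s, ZMod.stdAddChar (k * (i : ZMod p))‖ ^ 2 =
      (p : ℝ) * s := by
  have key : ∑ k : ZMod p, (starRingEnd ℂ (∑ i ∈ Finset.range s, ZMod.stdAddChar (k * (i : ZMod p)))
      * ∑ i ∈ Finset.range s, ZMod.stdAddChar (k * (i : ZMod p))) = (p : ℂ) * s := by
    simp only [map_sum, Finset.sum_mul_sum, ← AddChar.map_neg_eq_conj, ← AddChar.map_add_eq_mul]
    rw [Finset.sum_comm]
    have : ∀ i ∈ Finset.range s, ∑ k : ZMod p, ∑ j ∈ Finset.range s,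
        (ZMod.stdAddChar (-(k * (i : ZMod p)) + k * (j : ZMod p)) : ℂ) = p := fun i hi => by
      rw [Finset.sum_comm, Finset.sum_eq_single_of_mem i hi]
      · simp
      · intro j hj hji
        have h := AddChar.sum_mulShift ((j : ZMod p) - i) (ZMod.isPrimitive_stdAddChar p)
        rw [if_neg] at h
        · rw [← Nat.cast_zero, ← h]
          exact Finset.sum_congr rfl fun k _ => by ring_nf
        · intro h0
          apply hji
          have h1 := congrArg ZMod.val (sub_eq_zero.1 h0)
          rw [Finset.mem_range] at hi hj
          rwa [ZMod.val_cast_of_lt (by omega), ZMod.val_cast_of_lt (by omega)] at h1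
    rw [Finset.sum_congr rfl this]
    simp [mul_comm]
  simp only [Complex.conj_mul'] at key
  exact_mod_cast key

/-- The sum of `χ` over the square roots of `z`. -/
noncomputable def sqrtSum {p : ℕ} [NeZero p] (χ : AddChar (ZMod p) ℂ) (z : ZMod p) : ℂ :=
  ∑ x : ZMod p, if x ^ 2 = z then χ x else 0

theorem norm_sqrtSum_le {p : ℕ} [Fact p.Prime] (χ : AddChar (ZMod p) ℂ) (z : ZMod p) :
    ‖sqrtSum χ z‖ ≤ 2 := by
  unfold sqrtSum
  rw [← Finset.sum_filter]
  refine (norm_sum_le _ _).trans ?_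
  simp only [AddChar.norm_apply, Finset.sum_const, nsmul_eq_mul, mul_one]
  have hle : (Finset.univ.filter fun x : ZMod p => x ^ 2 = z).card ≤ 2 := by
    by_cases h : ∃ y : ZMod p, y ^ 2 = z
    · obtain ⟨y, rfl⟩ := h
      refine (Finset.card_le_card (t := {y, -y}) fun x hx => ?_).trans Finset.card_le_two
      simpa [sq_eq_sq_iff_eq_or_eq_neg] using hx
    · push Not at h
      simp [h]
  exact_mod_cast hle

/-- Fourier inversion for `sqrtSum` over a sumset of two intervals. -/
theorem mul_sum_sum_sqrtSum {p : ℕ} [NeZero p] (χ : AddChar (ZMod p) ℂ) (t : ZMod p) (s h : ℕ) :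
    (p : ℂ) * ∑ m ∈ Finset.range h, ∑ i ∈ Finset.range s, sqrtSum χ (t + m + i) =
      ∑ k : ZMod p, (∑ x : ZMod p, χ x * ZMod.stdAddChar (k * x ^ 2)) *
        (ZMod.stdAddChar (-(k * t)) *
          (starRingEnd ℂ (∑ i ∈ Finset.range s, ZMod.stdAddChar (k * (i : ZMod p))) *
            starRingEnd ℂ (∑ m ∈ Finset.range h, ZMod.stdAddChar (k * (m : ZMod p))))) := by
  have h1 : ∀ z : ZMod p, (p : ℂ) * sqrtSum χ z = ∑ k : ZMod p,
      (∑ x : ZMod p, χ x * ZMod.stdAddChar (k * x ^ 2)) * ZMod.stdAddChar (-(k * z)) := fun z => by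
    simp only [Finset.sum_mul, sqrtSum, Finset.mul_sum]
    rw [Finset.sum_comm]
    refine Finset.sum_congr rfl fun x _ => ?_
    have h := AddChar.sum_mulShift (x ^ 2 - z) (ZMod.isPrimitive_stdAddChar p)
    have h' : ∑ k : ZMod p, χ x * ZMod.stdAddChar (k * x ^ 2) * ZMod.stdAddChar (-(k * z)) =
        χ x * ∑ k : ZMod p, ZMod.stdAddChar (k * (x ^ 2 - z)) := by
      rw [Finset.mul_sum]
      refine Finset.sum_congr rfl fun k _ => ?_
      rw [mul_assoc, ← AddChar.map_add_eq_mul]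
      ring_nf
    rw [h', h]
    by_cases hx : x ^ 2 = z <;> simp [hx, sub_eq_zero, mul_comm]
  simp only [Finset.mul_sum, h1]
  simp only [map_sum, ← AddChar.map_neg_eq_conj]
  rw [Finset.sum_congr rfl fun m _ => Finset.sum_comm, Finset.sum_comm]
  refine Finset.sum_congr rfl fun k _ => ?_
  simp only [← Finset.mul_sum]
  congr 1
  simp only [Finset.sum_mul_sum]
  rw [Finset.mul_sum, Finset.sum_comm]
  refine Finset.sum_congr rfl fun i _ => ?_
  rw [Finset.mul_sum]
  refine Finset.sum_congr rfl fun m _ => ?_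
  rw [← AddChar.map_add_eq_mul, ← AddChar.map_add_eq_mul]
  ring_nf

/-- The frequency `k = 0` gives the main term. At the others the Gauss sum has norm `√p`, and
Cauchy–Schwarz with the second moments of both intervals bounds the rest. The second interval is
what makes a saving possible without logarithmic estimates. -/
theorem norm_sum_sum_sqrtSum_sub_le {p : ℕ} [Fact p.Prime] (hp : p ≠ 2)
    (χ : AddChar (ZMod p) ℂ) (t : ZMod p) {s h : ℕ} (hs : s ≤ p) (hh : h ≤ p) :
    ‖∑ m ∈ Finset.range h, ∑ i ∈ Finset.range s, sqrtSum χ (t + m + i) -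
      (if χ = 0 then (s * h : ℂ) else 0)‖ ≤ p * √h := by
  classical
  have hp0 : (0 : ℝ) < p := by exact_mod_cast (Fact.out : p.Prime).pos
  have hp0' : (p : ℂ) ≠ 0 := by exact_mod_cast hp0.ne'
  have inv := mul_sum_sum_sqrtSum χ t s h
  rw [← Finset.add_sum_erase _ _ (Finset.mem_univ 0)] at inv
  have zero : (∑ x : ZMod p, χ x * ZMod.stdAddChar (0 * x ^ 2)) *
        (ZMod.stdAddChar (-(0 * t)) *
          (starRingEnd ℂ (∑ i ∈ Finset.range s, ZMod.stdAddChar (0 * (i : ZMod p))) *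
            starRingEnd ℂ (∑ m ∈ Finset.range h, ZMod.stdAddChar (0 * (m : ZMod p))))) =
      (p : ℂ) * (if χ = 0 then (s * h : ℂ) else 0) := by
    simp only [zero_mul, neg_zero, AddChar.map_zero_eq_one, mul_one, one_mul, AddChar.sum_eq_ite,
      Finset.sum_const, Finset.card_range, ZMod.card, nsmul_eq_mul, map_natCast]
    split_ifs <;> simp
  rw [zero, ← sub_eq_iff_eq_add', ← mul_sub] at inv
  have norm_inv := congrArg norm inv
  rw [norm_mul, Complex.norm_natCast] at norm_inv
  set I : ZMod p → ℝ := fun k => ‖∑ i ∈ Finset.range s, ZMod.stdAddChar (k * (i : ZMod p))‖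
  set J : ZMod p → ℝ := fun k => ‖∑ i ∈ Finset.range h, ZMod.stdAddChar (k * (i : ZMod p))‖
  have cs : ∑ k, I k * J k ≤ p * √s * √h := by
    refine abs_le_of_sq_le_sq' ?_ (by positivity) |>.2
    calc (∑ k, I k * J k) ^ 2 ≤ (∑ k, I k ^ 2) * ∑ k, J k ^ 2 :=
          Finset.sum_mul_sq_le_sq_mul_sq _ _ _
      _ = (p * s) * (p * h) := by
          rw [sum_norm_sq_sum_range_stdAddChar hs, sum_norm_sq_sum_range_stdAddChar hh]
      _ = (p * √s * √h) ^ 2 := by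
          rw [mul_pow, mul_pow, Real.sq_sqrt (by positivity), Real.sq_sqrt (by positivity)]; ring
  have bound : (p : ℝ) * ‖∑ m ∈ Finset.range h, ∑ i ∈ Finset.range s, sqrtSum χ (t + m + i) -
      (if χ = 0 then (s * h : ℂ) else 0)‖ ≤ p * (p * √h) := by
    rw [norm_inv]
    calc _ ≤ ∑ k ∈ Finset.univ.erase (0 : ZMod p), √p * (I k * J k) := by
          refine norm_sum_le_of_le _ fun k hk => ?_
          have hk0 : k ≠ 0 := Finset.ne_of_mem_erase hk
          have hG : ‖∑ x : ZMod p, χ x * ZMod.stdAddChar (k * x ^ 2)‖ = √p := by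
            rw [← norm_sq_sum_addChar_mul_stdAddChar_sq hp χ hk0, Real.sqrt_sq (norm_nonneg _)]
          rw [norm_mul, norm_mul, norm_mul, AddChar.norm_apply, hG, RCLike.norm_conj,
            RCLike.norm_conj, one_mul]
      _ ≤ ∑ k : ZMod p, √p * (I k * J k) :=
          Finset.sum_le_sum_of_subset_of_nonneg (Finset.erase_subset _ _) fun _ _ _ => by positivity
      _ = √p * ∑ k : ZMod p, I k * J k := by rw [Finset.mul_sum]
      _ ≤ √p * (p * √s * √h) := by gcongr
      _ ≤ √p * (p * √p * √h) := by gcongr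
      _ = (√p * √p) * (p * √h) := by ring
      _ = p * (p * √h) := by rw [Real.mul_self_sqrt hp0.le]
  exact le_of_mul_le_mul_left bound hp0

/-- A unit shift of the window exchanges one term for another, each of norm at most 2. -/
theorem norm_sum_sqrtSum_shift_sub_le {p : ℕ} [Fact p.Prime] (χ : AddChar (ZMod p) ℂ)
    (t : ZMod p) (s m : ℕ) :
    ‖∑ i ∈ Finset.range s, sqrtSum χ (t + m + i) - ∑ i ∈ Finset.range s, sqrtSum χ (t + i)‖
      ≤ 4 * m := by
  induction m with
  | zero => simp
  | succ m ih =>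
    have e : ∑ i ∈ Finset.range s, sqrtSum χ (t + (m + 1 : ℕ) + i) =
        ∑ i ∈ Finset.range s, sqrtSum χ (t + m + i) +
          (sqrtSum χ (t + m + s) - sqrtSum χ (t + m)) := by
      have := Finset.sum_range_succ' (fun i : ℕ => sqrtSum χ (t + m + i)) s
      rw [Finset.sum_range_succ] at this
      have h : ∀ i : ℕ, t + (m + 1 : ℕ) + i = t + m + (i + 1 : ℕ) := fun i => by push_cast; ring
      simp only [h]
      simp only [Nat.cast_zero, add_zero] at this
      linear_combination -this
    rw [e, add_sub_right_comm]
    refine (norm_add_le _ _).trans ?_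
    have := (norm_sub_le (sqrtSum χ (t + m + s)) (sqrtSum χ (t + m))).trans
      (add_le_add (norm_sqrtSum_le χ _) (norm_sqrtSum_le χ _))
    push_cast
    linarith

/-- Averaging over `h` shifts has error `p / √h`; undoing each shift costs at most `4h`. -/
theorem norm_sum_sqrtSum_sub_le {p : ℕ} [Fact p.Prime] (hp : p ≠ 2) (χ : AddChar (ZMod p) ℂ)
    (t : ZMod p) {s h : ℕ} (hs : s ≤ p) (hh : h ≤ p) (h0 : 0 < h) :
    ‖∑ i ∈ Finset.range s, sqrtSum χ (t + i) - (if χ = 0 then (s : ℂ) else 0)‖ ≤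
      4 * h + p / √h := by
  classical
  have hpos : (0 : ℝ) < h := by exact_mod_cast h0
  have key : (h : ℝ) * ‖∑ i ∈ Finset.range s, sqrtSum χ (t + i) - (if χ = 0 then (s : ℂ) else 0)‖ ≤
      h * (4 * h + p / √h) := by
    have e : (h : ℂ) * (∑ i ∈ Finset.range s, sqrtSum χ (t + i) - (if χ = 0 then (s : ℂ) else 0)) =
        (∑ m ∈ Finset.range h, ∑ i ∈ Finset.range s, sqrtSum χ (t + m + i) -
          (if χ = 0 then (s * h : ℂ) else 0)) -
        ∑ m ∈ Finset.range h, (∑ i ∈ Finset.range s, sqrtSum χ (t + m + i) -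
          ∑ i ∈ Finset.range s, sqrtSum χ (t + i)) := by
      rw [Finset.sum_sub_distrib, Finset.sum_const, Finset.card_range, nsmul_eq_mul]
      split_ifs <;> ring
    rw [← Complex.norm_natCast, ← norm_mul, e]
    refine (norm_sub_le _ _).trans ?_
    rw [Complex.norm_natCast]
    have h1 := norm_sum_sum_sqrtSum_sub_le hp χ t hs hh
    have h2 : ‖∑ m ∈ Finset.range h, (∑ i ∈ Finset.range s, sqrtSum χ (t + m + i) -
          ∑ i ∈ Finset.range s, sqrtSum χ (t + i))‖ ≤ ∑ m ∈ Finset.range h, (4 * h : ℝ) := by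
      refine norm_sum_le_of_le _ fun m hm => (norm_sum_sqrtSum_shift_sub_le χ t s m).trans ?_
      have : (m : ℝ) ≤ h := by exact_mod_cast (Finset.mem_range.1 hm).le
      linarith
    rw [Finset.sum_const, Finset.card_range, nsmul_eq_mul] at h2
    have h3 : (h : ℝ) * (p / √h) = p * √h := by
      have : √(h : ℝ) * √h = h := Real.mul_self_sqrt hpos.le
      have h4 : √(h : ℝ) ≠ 0 := (Real.sqrt_pos.2 hpos).ne'
      field_simp
      rw [sq, this, mul_comm]
    rw [mul_add, h3]
    linarith
  exact le_of_mul_le_mul_left key hpos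

theorem sum_ite_val_sq_sub_lt {p : ℕ} [NeZero p] (χ : AddChar (ZMod p) ℂ) (t : ZMod p) {s : ℕ}
    (hs : s ≤ p) :
    ∑ x : ZMod p, (if (x ^ 2 - t).val < s then χ x else 0) =
      ∑ i ∈ Finset.range s, sqrtSum χ (t + i) := by
  unfold sqrtSum
  rw [Finset.sum_comm]
  refine Finset.sum_congr rfl fun x _ => ?_
  have : ∀ i ∈ Finset.range s, (if x ^ 2 = t + i then χ x else 0) =
      if (x ^ 2 - t).val = i then χ x else 0 := fun i hi => by
    have hi' : i < p := (Finset.mem_range.1 hi).trans_le hs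
    have : x ^ 2 = t + i ↔ (x ^ 2 - t).val = i := by
      constructor
      · intro h
        rw [h, add_sub_cancel_left, ZMod.val_cast_of_lt hi']
      · intro h
        rw [← h, ZMod.natCast_zmod_val]; ring
    simp only [this]
  rw [Finset.sum_congr rfl this, Finset.sum_ite_eq]
  simp only [Finset.mem_range]

/-- Squares modulo a large prime, twisted by any additive character, are equidistributed in
intervals. -/
theorem exists_forall_prime_norm_sum_sq_mem_interval_sub_le {η : ℝ} (hη : 0 < η) :
    ∃ P : ℕ, ∀ p : ℕ, P ≤ p → ∀ [Fact p.Prime] (χ : AddChar (ZMod p) ℂ) (t : ZMod p) (s : ℕ),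
      s ≤ p → ‖∑ x : ZMod p, (if (x ^ 2 - t).val < s then χ x else 0) -
        (if χ = 0 then (s : ℂ) else 0)‖ ≤ η * p := by
  -- `h ≥ 4/η²` gives `p/√h ≤ ηp/2`, and `p ≥ 8h/η` gives `4h ≤ ηp/2`; the 3 below excludes `p = 2`.
  obtain ⟨h, hh⟩ := exists_nat_ge (max 1 (4 / η ^ 2))
  have h1 : (1 : ℝ) ≤ h := (le_max_left _ _).trans hh
  have h2 : 4 / η ^ 2 ≤ h := (le_max_right _ _).trans hh
  obtain ⟨P, hP⟩ := exists_nat_ge (8 * h / η)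
  refine ⟨max P (max h 3), fun p hp _ χ t s hs => ?_⟩
  have hpP : (P : ℝ) ≤ p := by exact_mod_cast (le_max_left _ _).trans hp
  have hph : h ≤ p := (le_max_left _ _).trans ((le_max_right _ _).trans hp)
  have hp3 : 3 ≤ p := (le_max_right _ _).trans ((le_max_right _ _).trans hp)
  rw [sum_ite_val_sq_sub_lt χ t hs]
  refine (norm_sum_sqrtSum_sub_le (by omega) χ t hs hph (by exact_mod_cast h1)).trans ?_
  have e1 : 4 * (h : ℝ) ≤ η / 2 * p := by
    have := hP.trans hpP
    rw [div_le_iff₀ hη] at this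
    linarith
  have e2 : (p : ℝ) / √h ≤ η / 2 * p := by
    have hs : 2 / η ≤ √h := by
      refine Real.le_sqrt_of_sq_le ?_
      rw [div_pow]; norm_num; exact h2
    have hs0 : 0 < 2 / η := by positivity
    rw [div_le_iff₀ (hs0.trans_le hs)]
    calc (p : ℝ) = η / 2 * p * (2 / η) := by field_simp
      _ ≤ η / 2 * p * √h := by gcongr
  linarith

/-! ### Encoding colors on the moment curve. -/

/-- On the curve `(i, i², i³)` the equation `a - d = 3 (b - c)` has only trivial solutions. -/
theorem momentCurve_eq_of_sub_eq_three_mul_sub {a b c d : ℤ} (h₁ : a - d = 3 * (b - c))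
    (h₂ : a ^ 2 - d ^ 2 = 3 * (b ^ 2 - c ^ 2)) (h₃ : a ^ 3 - d ^ 3 = 3 * (b ^ 3 - c ^ 3)) :
    a = d ∧ b = c := by
  have hbc : b = c := by
    by_contra hne
    have h0 : b - c ≠ 0 := sub_ne_zero.2 hne
    -- If `b ≠ c`, the first two equations make `d, c, b, a` a 4-AP, on which the third difference
    -- of cubes is `6(b - c)³ ≠ 0`.
    have hs : a + d = b + c := by
      have : (b - c) * (3 * (a + d) - 3 * (b + c)) = 0 := by
        linear_combination h₂ - (a + d) * h₁
      rcases mul_eq_zero.1 this with h | h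
      · exact absurd h h0
      · linarith
    have ha : a = 2 * b - c := by linarith
    have hd : d = 2 * c - b := by linarith
    subst ha hd
    have : (b - c) ^ 3 = 0 := by linarith
    exact h0 (pow_eq_zero_iff (by norm_num) |>.1 this)
  exact ⟨by subst hbc; linarith, hbc⟩

/-- Digits in base `B` of a vanishing expansion vanish. -/
theorem eq_zero_of_add_mul_add_sq_mul_eq_zero {B x y z : ℤ} (hx : |x| < B) (hy : |y| < B)
    (h : x + B * y + B ^ 2 * z = 0) : x = 0 ∧ y = 0 ∧ z = 0 := by
  have hx0 : x = 0 := Int.eq_zero_of_abs_lt_dvd ⟨-(y + B * z), by linear_combination h⟩ hx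
  have hB : B ≠ 0 := by have := abs_nonneg x; omega
  have h' : y + B * z = 0 := by
    apply mul_left_cancel₀ hB
    linear_combination h - hx0
  have hy0 : y = 0 := Int.eq_zero_of_abs_lt_dvd ⟨-z, by linear_combination h'⟩ hy
  refine ⟨hx0, hy0, ?_⟩
  apply mul_left_cancel₀ hB
  linear_combination h' - hy0

/-- The moment curve `(i, i², i³)` for `i < R`, written in base `8 R²`. -/
def momentCode (R i : ℤ) : ℤ := i + 8 * R ^ 2 * i ^ 2 + (8 * R ^ 2) ^ 2 * i ^ 3

theorem momentCode_nonneg {R i : ℤ} (h : 0 ≤ i) : 0 ≤ momentCode R i := by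
  unfold momentCode; positivity

theorem momentCode_le {R i : ℤ} (h₀ : 0 ≤ i) (h : i < R) : momentCode R i ≤ 73 * R ^ 7 := by
  have hR : 1 ≤ R := by omega
  have e1 : i ^ 2 ≤ R ^ 2 := by gcongr
  have e2 : i ^ 3 ≤ R ^ 3 := by gcongr
  have e3 : R ≤ R ^ 7 := le_self_pow₀ hR (by norm_num)
  have e4 : R ^ 4 ≤ R ^ 7 := pow_le_pow_right₀ hR (by norm_num)
  calc momentCode R i ≤ R + 8 * R ^ 2 * R ^ 2 + (8 * R ^ 2) ^ 2 * R ^ 3 := by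
        unfold momentCode; gcongr
    _ = R + 8 * R ^ 4 + 64 * R ^ 7 := by ring
    _ ≤ 73 * R ^ 7 := by linarith

/-- Base `8R²` prevents carries: in the two lower digits the combination is at most `4R²` in
absolute value, so each power satisfies the relation separately. -/
theorem momentCode_eq_of_sub_eq {R a b c d : ℤ} (ha₀ : 0 ≤ a) (ha : a < R) (hb₀ : 0 ≤ b)
    (hb : b < R) (hc₀ : 0 ≤ c) (hc : c < R) (hd₀ : 0 ≤ d) (hd : d < R)
    (h : momentCode R a - 3 * momentCode R b + 3 * momentCode R c - momentCode R d = 0) :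
    a = d ∧ b = c := by
  have hR : 1 ≤ R := by omega
  have sq : ∀ i : ℤ, 0 ≤ i → i < R → 0 ≤ i ^ 2 ∧ i ^ 2 ≤ R ^ 2 := fun i h0 h1 =>
    ⟨by positivity, by gcongr⟩
  have hRR : R ≤ R ^ 2 := le_self_pow₀ hR (by norm_num)
  obtain ⟨ha1, ha2⟩ := sq a ha₀ ha
  obtain ⟨hb1, hb2⟩ := sq b hb₀ hb
  obtain ⟨hc1, hc2⟩ := sq c hc₀ hc
  obtain ⟨hd1, hd2⟩ := sq d hd₀ hd
  obtain ⟨h1, h2, h3⟩ := eq_zero_of_add_mul_add_sq_mul_eq_zero (B := 8 * R ^ 2)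
    (x := a - 3 * b + 3 * c - d) (y := a ^ 2 - 3 * b ^ 2 + 3 * c ^ 2 - d ^ 2)
    (z := a ^ 3 - 3 * b ^ 3 + 3 * c ^ 3 - d ^ 3)
    (by rw [abs_lt]; constructor <;> linarith) (by rw [abs_lt]; constructor <;> linarith)
    (by simp only [momentCode] at h; linear_combination h)
  exact momentCurve_eq_of_sub_eq_three_mul_sub (by linarith) (by linarith) (by linarith)

/-! ### Colorings of a cyclic group. -/

/-- Four integers in `[0, 4 w)` forming a progression modulo `4 w`, the inner two in one block of
length `w` and the outer two in one block of length `w`, form a progression of integers. -/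
theorem exists_progression_of_block_eq {w n₀ n₁ n₂ n₃ : ℤ} (h₀ : 0 ≤ n₀) (h₀' : n₀ < 4 * w)
    (h₁ : 0 ≤ n₁) (h₁' : n₁ < 4 * w)
    (h₃ : 0 ≤ n₃) (h₃' : n₃ < 4 * w)
    (hm₀ : 4 * w ∣ n₀ - 2 * n₁ + n₂) (hm₁ : 4 * w ∣ n₁ - 2 * n₂ + n₃)
    (hin : n₁ / w = n₂ / w) (hout : n₀ / w = n₃ / w) :
    n₁ = n₀ + (n₂ - n₁) ∧ n₂ = n₀ + 2 * (n₂ - n₁) ∧ n₃ = n₀ + 3 * (n₂ - n₁) := by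
  have hw : 0 < w := by omega
  have close : ∀ x y : ℤ, x / w = y / w → |x - y| < w := fun x y h => by
    have hx := Int.emod_add_mul_ediv x w
    have hy := Int.emod_add_mul_ediv y w
    have hx1 := Int.emod_nonneg x hw.ne'
    have hy1 := Int.emod_nonneg y hw.ne'
    have hx2 := Int.emod_lt_of_pos x hw
    have hy2 := Int.emod_lt_of_pos y hw
    rw [h] at hx
    rw [abs_lt]; constructor <;> linarith
  obtain ⟨a, b⟩ := abs_lt.1 (close _ _ hin)
  obtain ⟨c, d⟩ := abs_lt.1 (close _ _ hout)
  -- Here `|n₃ - n₀| < w` and `3|n₂ - n₁| < 3w`.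
  have e3 : n₃ - n₀ - 3 * (n₂ - n₁) = 0 :=
    Int.eq_zero_of_abs_lt_dvd (m := 4 * w)
      (by rw [show n₃ - n₀ - 3 * (n₂ - n₁) = n₁ - 2 * n₂ + n₃ - (n₀ - 2 * n₁ + n₂) by ring]
          exact dvd_sub hm₁ hm₀) (by rw [abs_lt]; constructor <;> linarith)
  -- By `e3` the quantity equals `(2n₀ + n₃)/3 - n₁`, a difference of two numbers in `[0, 4w)`.
  have e0 : n₀ - 2 * n₁ + n₂ = 0 :=
    Int.eq_zero_of_abs_lt_dvd hm₀ (by rw [abs_lt]; constructor <;> linarith)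
  refine ⟨?_, ?_, ?_⟩ <;> linarith

/-- A coloring of `[4w]` without symmetrically colored 4-APs, refined by blocks of length `w`, is a
coloring of `ℤ/4wℤ` all of whose symmetrically colored 4-APs are constant. -/
theorem eq_zero_of_symmetric_zmod {κ : Type*} {w q : ℕ} (hq : q = 4 * w) [NeZero q] {c : ℤ → κ}
    (hc : AvoidsSymmetric4AP (Set.Icc (1 : ℤ) (q : ℤ)) c) {y e : ZMod q}
    (hout : c (y.val + 1) = c ((y + 3 * e).val + 1))
    (hin : c ((y + e).val + 1) = c ((y + 2 * e).val + 1))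
    (bout : y.val / w = (y + 3 * e).val / w) (bin : (y + e).val / w = (y + 2 * e).val / w) :
    e = 0 := by
  have lt : ∀ z : ZMod q, (z.val : ℤ) < 4 * (w : ℤ) := fun z => by
    have := ZMod.val_lt z; omega
  have dvd : ∀ z₀ z₁ z₂ : ZMod q, z₀ - 2 * z₁ + z₂ = 0 →
      (4 * (w : ℤ)) ∣ (z₀.val : ℤ) - 2 * z₁.val + z₂.val := fun z₀ z₁ z₂ h => by
    have : ((4 * w : ℕ) : ℤ) ∣ (z₀.val : ℤ) - 2 * z₁.val + z₂.val := by
      rw [← hq, ← ZMod.intCast_zmod_eq_zero_iff_dvd]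
      simpa using h
    simpa using this
  obtain ⟨e1, e2, e3⟩ := exists_progression_of_block_eq (w := w)
    (n₂ := (y + 2 * e).val) (by positivity) (lt y)
    (by positivity) (lt (y + e)) (by positivity)
    (lt (y + 3 * e)) (dvd y (y + e) (y + 2 * e) (by ring))
    (dvd (y + e) (y + 2 * e) (y + 3 * e) (by ring)) (by exact_mod_cast bin)
    (by exact_mod_cast bout)
  -- Residues run over `0, …, q - 1`, while the coloring lives on `1, …, q`; hence the shift by one.
  have mem : ∀ z : ZMod q, (z.val : ℤ) + 1 ∈ Set.Icc (1 : ℤ) (q : ℤ) := fun z =>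
    ⟨by omega, by have := ZMod.val_lt z; omega⟩
  by_contra he
  set d : ℤ := ((y + 2 * e).val : ℤ) - (y + e).val with hd
  have hd0 : d ≠ 0 := by
    intro h0
    apply he
    have : (y + e).val = y.val := by omega
    simpa using ZMod.val_injective _ this
  have f1 : (y.val : ℤ) + 1 + d = (y + e).val + 1 := by linarith
  have f2 : (y.val : ℤ) + 1 + 2 * d = (y + 2 * e).val + 1 := by linarith
  have f3 : (y.val : ℤ) + 1 + 3 * d = (y + 3 * e).val + 1 := by linarith
  refine hc (y.val + 1) d hd0 (mem y) ?_ ?_ ?_ ?_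
  · rw [f1]; exact mem _
  · rw [f2]; exact mem _
  · rw [f3]; exact mem _
  · rw [f1, f2, f3]; exact ⟨hout, hin⟩

/-! ### Fourier coefficients and 4-AP count of the quadratic set. -/

/-- The set of `n` for which `(n mod p)²` lies in an interval of length `s` whose position depends
on `n mod q`. -/
def quadraticSet {N p q : ℕ} [NeZero N] (e : ZMod N ≃+* ZMod p × ZMod q)
    (T : ZMod q → ZMod p) (s : ℕ) : Finset (ZMod N) :=
  Finset.univ.filter fun n => ((e n).1 ^ 2 - T (e n).2).val < s

theorem mem_quadraticSet {N p q : ℕ} [NeZero N] {e : ZMod N ≃+* ZMod p × ZMod q}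
    {T : ZMod q → ZMod p} {s : ℕ} {n : ZMod N} :
    n ∈ quadraticSet e T s ↔ ((e n).1 ^ 2 - T (e n).2).val < s := by
  simp [quadraticSet]

/-- A character splits as `χ₁(x) χ₂(y)`. The bound `H` is uniform in the position `t`, so it applies
on each fiber over `y` regardless of `T`. -/
theorem norm_sum_quadraticSet_sub_le {N p q : ℕ} [NeZero N] [NeZero p] [NeZero q] {δ : ℝ}
    (e : ZMod N ≃+* ZMod p × ZMod q) (T : ZMod q → ZMod p) {s : ℕ}
    (H : ∀ (χ : AddChar (ZMod p) ℂ) (t : ZMod p),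
      ‖∑ x : ZMod p, (if (x ^ 2 - t).val < s then χ x else 0) -
        (if χ = 0 then (s : ℂ) else 0)‖ ≤ δ) (ψ : AddChar (ZMod N) ℂ) :
    ‖∑ n ∈ quadraticSet e T s, ψ n - (if ψ = 0 then (q * s : ℂ) else 0)‖ ≤ q * δ := by
  classical
  set χ₁ : AddChar (ZMod p) ℂ := ψ.compAddMonoidHom
    (e.symm.toAddEquiv.toAddMonoidHom.comp (AddMonoidHom.inl (ZMod p) (ZMod q))) with hχ₁
  set χ₂ : AddChar (ZMod q) ℂ := ψ.compAddMonoidHom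
    (e.symm.toAddEquiv.toAddMonoidHom.comp (AddMonoidHom.inr (ZMod p) (ZMod q))) with hχ₂
  have split : ∀ x y, ψ (e.symm (x, y)) = χ₂ y * χ₁ x := fun x y => by
    have : (x, y) = (0, y) + (x, 0) := by simp
    rw [this, map_add, AddChar.map_add_eq_mul]
    rfl
  have hzero : ψ = 0 ↔ χ₁ = 0 ∧ χ₂ = 0 := by
    constructor
    · intro h
      constructor <;> ext x <;> simp [hχ₁, hχ₂, h]
    · rintro ⟨h₁, h₂⟩
      ext n
      obtain ⟨⟨x, y⟩, rfl⟩ := e.symm.surjective n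
      simp [split, h₁, h₂]
  have sum_eq : ∑ n ∈ quadraticSet e T s, ψ n =
      ∑ y, χ₂ y * ∑ x, (if (x ^ 2 - T y).val < s then χ₁ x else 0) := by
    rw [quadraticSet, Finset.sum_filter, ← e.symm.toEquiv.sum_comp, Fintype.sum_prod_type_right]
    refine Finset.sum_congr rfl fun y _ => ?_
    rw [Finset.mul_sum]
    refine Finset.sum_congr rfl fun x _ => ?_
    have h1 : e.symm.toEquiv (x, y) = e.symm (x, y) := rfl
    rw [h1, RingEquiv.apply_symm_apply, split]
    split_ifs <;> simp
  have main_eq : (if ψ = 0 then (q * s : ℂ) else 0) =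
      ∑ y, χ₂ y * (if χ₁ = 0 then (s : ℂ) else 0) := by
    rw [← Finset.sum_mul, AddChar.sum_eq_ite, ZMod.card]
    by_cases h₁ : χ₁ = 0 <;> by_cases h₂ : χ₂ = 0 <;> simp [hzero, h₁, h₂]
  rw [sum_eq, main_eq, ← Finset.sum_sub_distrib]
  rw [show (q : ℝ) * δ = ∑ _y : ZMod q, δ by simp]
  refine norm_sum_le_of_le _ fun y _ => ?_
  rw [← mul_sub, norm_mul, AddChar.norm_apply, one_mul]
  exact H χ₁ (T y)

theorem isFourierUniform_of_norm_sum_le {N : ℕ} [NeZero N] {η : ℝ} {A : Finset (ZMod N)}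
    (H : ∀ ψ : AddChar (ZMod N) ℂ, ψ ≠ 0 → ‖∑ n ∈ A, ψ n‖ ≤ η * N) : IsFourierUniform η A := by
  classical
  intro r hr
  have hN : (0 : ℝ) < N := by exact_mod_cast NeZero.pos N
  set ψ : AddChar (ZMod N) ℂ := AddChar.mulShift ZMod.stdAddChar (-r)
  have hψ : ψ ≠ 0 := ZMod.isPrimitive_stdAddChar N (neg_ne_zero.2 hr)
  have e : ZMod.dft ((A : Set (ZMod N)).indicator (1 : ZMod N → ℂ)) r = ∑ n ∈ A, ψ n := by
    rw [ZMod.dft_apply, ← Finset.sum_subset (Finset.subset_univ A)]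
    · refine Finset.sum_congr rfl fun n hn => ?_
      rw [Set.indicator_of_mem (Finset.mem_coe.2 hn), Pi.one_apply, smul_eq_mul, mul_one,
        AddChar.mulShift_apply]
      ring_nf
    · intro n _ hn
      rw [Set.indicator_of_notMem (by simpa using hn), smul_zero]
  rw [fourierCoeffZMod, e, norm_mul, norm_inv, Complex.norm_natCast, inv_mul_le_iff₀ hN, mul_comm]
  exact H ψ hψ

/-- Only `p` differences have zero second component, so at most `Np` of the `N²` pairs count. -/
theorem lambda4_le_inv {N p q : ℕ} [NeZero N] [NeZero p] [NeZero q] (hN : N = p * q)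
    (e : ZMod N ≃+* ZMod p × ZMod q) (A : Finset (ZMod N))
    (H : ∀ n d, n ∈ A → n + d ∈ A → n + 2 * d ∈ A → n + 3 * d ∈ A → (e d).2 = 0) :
    Lambda4 ((A : Set (ZMod N)).indicator 1) ≤ 1 / q := by
  classical
  have hN0 : (0 : ℝ) < N := by exact_mod_cast NeZero.pos N
  have hq0 : (0 : ℝ) < q := by exact_mod_cast NeZero.pos q
  set f : ZMod N → ℝ := (A : Set (ZMod N)).indicator 1
  have f1 : ∀ n, n ∈ A → f n = 1 := fun n hn => by simp [f, hn]
  have f0 : ∀ n, n ∉ A → f n = 0 := fun n hn => by simp [f, hn]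
  have count : ∑ d : ZMod N, (if (e d).2 = 0 then (1 : ℝ) else 0) = p := by
    rw [← e.symm.toEquiv.sum_comp, Fintype.sum_prod_type]
    simp
  have le : ∀ n d, f n * f (n + d) * f (n + 2 * d) * f (n + 3 * d) ≤
      if (e d).2 = 0 then (1 : ℝ) else 0 := fun n d => by
    by_cases h : n ∈ A ∧ n + d ∈ A ∧ n + 2 * d ∈ A ∧ n + 3 * d ∈ A
    · obtain ⟨h0, h1, h2, h3⟩ := h
      rw [if_pos (H n d h0 h1 h2 h3), f1 _ h0, f1 _ h1, f1 _ h2, f1 _ h3]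
      norm_num
    · have : f n * f (n + d) * f (n + 2 * d) * f (n + 3 * d) = 0 := by
        by_contra hne
        simp only [mul_eq_zero, not_or] at hne
        exact h ⟨not_not.1 fun h => hne.1.1.1 (f0 _ h), not_not.1 fun h => hne.1.1.2 (f0 _ h),
          not_not.1 fun h => hne.1.2 (f0 _ h), not_not.1 fun h => hne.2 (f0 _ h)⟩
      rw [this]
      split_ifs <;> norm_num
  have total : ∑ n : ZMod N, ∑ d : ZMod N, f n * f (n + d) * f (n + 2 * d) * f (n + 3 * d) ≤
      N * p := by
    refine (Finset.sum_le_sum fun n _ => Finset.sum_le_sum fun d _ => le n d).trans ?_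
    rw [count]
    simp
  have hNr : (N : ℝ) = p * q := by exact_mod_cast hN
  rw [Lambda4, div_le_div_iff₀ (by positivity) hq0]
  calc _ ≤ (N * p : ℝ) * q := by gcongr
    _ = 1 * (N : ℝ) ^ 2 := by rw [sq]; nth_rw 3 [hNr]; ring

/-- Intervals of length `s` in `ℤ/pℤ` whose positions are multiples `4 s g` do not solve the 4-AP
identity for quadratics unless the multipliers do. -/
theorem sub_eq_zero_of_val_lt {p s : ℕ} [NeZero p] {G : ℤ} (hp : (16 * G + 4) * s ≤ p)
    {x d : ZMod p} {g₀ g₁ g₂ g₃ : ℤ} (hg₀ : 0 ≤ g₀) (hg₀' : g₀ ≤ G) (hg₁ : 0 ≤ g₁) (hg₁' : g₁ ≤ G)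
    (hg₂ : 0 ≤ g₂) (hg₂' : g₂ ≤ G) (hg₃ : 0 ≤ g₃) (hg₃' : g₃ ≤ G)
    (h₀ : (x ^ 2 - ((4 * s * g₀ : ℤ) : ZMod p)).val < s)
    (h₁ : ((x + d) ^ 2 - ((4 * s * g₁ : ℤ) : ZMod p)).val < s)
    (h₂ : ((x + 2 * d) ^ 2 - ((4 * s * g₂ : ℤ) : ZMod p)).val < s)
    (h₃ : ((x + 3 * d) ^ 2 - ((4 * s * g₃ : ℤ) : ZMod p)).val < s) :
    g₀ - 3 * g₁ + 3 * g₂ - g₃ = 0 := by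
  obtain ⟨v₀, hv₀⟩ : ∃ v, v = (x ^ 2 - ((4 * s * g₀ : ℤ) : ZMod p)).val := ⟨_, rfl⟩
  obtain ⟨v₁, hv₁⟩ : ∃ v, v = ((x + d) ^ 2 - ((4 * s * g₁ : ℤ) : ZMod p)).val := ⟨_, rfl⟩
  obtain ⟨v₂, hv₂⟩ : ∃ v, v = ((x + 2 * d) ^ 2 - ((4 * s * g₂ : ℤ) : ZMod p)).val := ⟨_, rfl⟩
  obtain ⟨v₃, hv₃⟩ : ∃ v, v = ((x + 3 * d) ^ 2 - ((4 * s * g₃ : ℤ) : ZMod p)).val := ⟨_, rfl⟩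
  rw [← hv₀] at h₀
  rw [← hv₁] at h₁
  rw [← hv₂] at h₂
  rw [← hv₃] at h₃
  set D := g₀ - 3 * g₁ + 3 * g₂ - g₃ with hD
  -- Third differences of a quadratic vanish.
  have hdvd : (p : ℤ) ∣ (v₀ - 3 * v₁ + 3 * v₂ - v₃ : ℤ) + 4 * s * D := by
    rw [← ZMod.intCast_zmod_eq_zero_iff_dvd]
    push_cast
    rw [hv₀, hv₁, hv₂, hv₃, hD]
    simp only [ZMod.natCast_zmod_val]
    push_cast
    ring
  have hs : (0 : ℤ) < s := by omega
  have hD1 : D ≤ 4 * G := by omega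
  have hD2 : -(4 * G) ≤ D := by omega
  have hD3 : (s : ℤ) * D ≤ s * (4 * G) := mul_le_mul_of_nonneg_left hD1 hs.le
  have hD4 : (s : ℤ) * -(4 * G) ≤ s * D := mul_le_mul_of_nonneg_left hD2 hs.le
  -- The absolute value is less than `4s + 16Gs ≤ p`, so there is no wraparound.
  have hz : (v₀ - 3 * v₁ + 3 * v₂ - v₃ : ℤ) + 4 * s * D = 0 := by
    refine Int.eq_zero_of_abs_lt_dvd hdvd ?_
    rw [abs_lt]
    constructor <;> linarith
  have h4 : (4 * s : ℤ) ∣ v₀ - 3 * v₁ + 3 * v₂ - v₃ := ⟨-D, by linear_combination hz⟩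
  have hv : (v₀ - 3 * v₁ + 3 * v₂ - v₃ : ℤ) = 0 := by
    refine Int.eq_zero_of_abs_lt_dvd h4 ?_
    rw [abs_lt]
    constructor <;> omega
  rw [hv, zero_add] at hz
  exact (mul_eq_zero.1 hz).resolve_left (by positivity)

/-! ### Assembling the construction and choosing parameters. -/

/-- A coloring of `[4w]` without symmetrically colored 4-APs gives Fourier uniform sets with few
4-APs. -/
theorem IsLowerBound4AP.le_inv_of_hasColoring {w r : ℕ} (hw : 0 < w)
    (hcol : HasSymmetric4APFreeColoring (4 * w) r) {α ρ : ℝ}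
    (hα : α * (16 * (73 * (4 * r) ^ 7) + 4) ≤ 1) (hρ : IsLowerBound4AP α ρ) :
    ρ ≤ 1 / ((4 * w : ℕ) : ℝ) := by
  classical
  obtain ⟨c, hc⟩ := hcol
  obtain ⟨q, hq⟩ : ∃ q, q = 4 * w := ⟨_, rfl⟩
  rw [← hq] at hc ⊢
  have : NeZero q := ⟨by omega⟩
  refine le_of_forall_pos_le_add fun ε hε => ?_
  obtain ⟨η, hη, N₀, H⟩ := hρ ε hε
  obtain ⟨P, hP⟩ := exists_forall_prime_norm_sum_sq_mem_interval_sub_le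
    -- `η` serves the nontrivial characters, `ε/2` the density (trivial character).
    (show 0 < min η (ε / 2) by positivity)
  -- The other `ε/2`: `εp/2 ≥ 1` absorbs the rounding in `s = p / K`.
  obtain ⟨M, hM⟩ := exists_nat_ge (2 / ε)
  obtain ⟨p, hp, hprime⟩ := Nat.exists_infinite_primes (P + M + N₀ + q + 1)
  have : Fact p.Prime := ⟨hprime⟩
  have hcop : p.Coprime q :=
    Nat.coprime_of_lt_prime (NeZero.ne q) (by omega) hprime
  set N := p * q with hN
  have : NeZero N := ⟨mul_ne_zero hprime.ne_zero (NeZero.ne q)⟩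
  let e : ZMod N ≃+* ZMod p × ZMod q := ZMod.chineseRemainder hcop
  obtain ⟨G, hG⟩ : ∃ G : ℤ, G = 73 * (4 * (r : ℤ)) ^ 7 := ⟨_, rfl⟩
  obtain ⟨K, hK⟩ : ∃ K : ℕ, K = 16 * (73 * (4 * r) ^ 7) + 4 := ⟨_, rfl⟩
  have hKG : (K : ℤ) = 16 * G + 4 := by rw [hK, hG]; push_cast; rfl
  set s := p / K with hs
  have hsp : s ≤ p := Nat.div_le_self _ _
  have hsK : (16 * G + 4) * (s : ℤ) ≤ p := by
    rw [← hKG]; exact_mod_cast Nat.mul_div_le p K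
  -- Color and block packed in base 4, giving `4r` refined colors.
  let idx : ZMod q → ℤ := fun y => 4 * ((c (y.val + 1) : ℕ) : ℤ) + ((y.val / w : ℕ) : ℤ)
  have hblock : ∀ y : ZMod q, y.val / w < 4 := fun y => by
    rw [Nat.div_lt_iff_lt_mul hw, ← hq]; exact ZMod.val_lt y
  have hidx0 : ∀ y, 0 ≤ idx y := fun y => by positivity
  have hidx : ∀ y, idx y < 4 * (r : ℤ) := fun y => by
    have h1 := (c (y.val + 1)).isLt
    have h2 := hblock y
    simp only [idx]
    omega
  have hidx_eq : ∀ y z, idx y = idx z →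
      c (y.val + 1) = c (z.val + 1) ∧ y.val / w = z.val / w := fun y z h => by
    have h1 := hblock y
    have h2 := hblock z
    simp only [idx] at h
    generalize y.val / w = b₁ at *
    generalize z.val / w = b₂ at *
    exact ⟨Fin.ext (by omega), by omega⟩
  let g : ZMod q → ℤ := fun y => momentCode (4 * r) (idx y)
  have hg0 : ∀ y, 0 ≤ g y := fun y => momentCode_nonneg (hidx0 y)
  have hgG : ∀ y, g y ≤ G := fun y => hG ▸ momentCode_le (hidx0 y) (hidx y)
  let T : ZMod q → ZMod p := fun y => ((4 * s * g y : ℤ) : ZMod p)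
  set A := quadraticSet e T s with hA
  have hNr : (N : ℝ) = p * q := by rw [hN]; push_cast; rfl
  have hp0 : (0 : ℝ) < p := by exact_mod_cast hprime.pos
  have hq0 : (0 : ℝ) < q := by exact_mod_cast NeZero.pos q
  have sums := norm_sum_quadraticSet_sub_le e T (s := s)
    (fun χ t => hP p (by omega) χ t s hsp)
  have hunif : IsFourierUniform η A := by
    refine isFourierUniform_of_norm_sum_le fun ψ hψ => ?_
    have := sums ψ
    rw [if_neg hψ, sub_zero] at this
    refine this.trans ?_
    rw [hNr]
    calc (q : ℝ) * (min η (ε / 2) * p) ≤ q * (η * p) := by gcongr; exact min_le_left _ _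
      _ = η * (p * q) := by ring
  have hcard : (α - ε) * (N : ℝ) ≤ A.card := by
    have h1 := sums 0
    rw [if_pos rfl] at h1
    simp only [AddChar.zero_apply, Finset.sum_const, nsmul_eq_mul, mul_one] at h1
    have h2 : |(A.card : ℝ) - q * s| ≤ q * (min η (ε / 2) * p) := by
      rw [← Real.norm_eq_abs, ← Complex.norm_real]
      push_cast
      exact h1
    have h3 := (abs_le.1 h2).1
    have h4 : q * (min η (ε / 2) * p) ≤ q * (ε / 2 * p) := by gcongr; exact min_le_right _ _
    have h5 : (p : ℝ) ≤ K * (s + 1) := by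
      have := (Nat.lt_mul_div_succ p (show 0 < K by omega)).le
      rw [← hs] at this
      exact_mod_cast this
    have h6 : α * p ≤ s + 1 := by
      rcases le_total α 0 with h | h
      · exact (mul_nonpos_of_nonpos_of_nonneg h hp0.le).trans (by positivity)
      · have hαK : α * K ≤ 1 := by rw [hK]; push_cast; exact hα
        calc α * p ≤ α * (K * (s + 1)) := by gcongr
          _ = α * K * (s + 1) := by ring
          _ ≤ 1 * (s + 1) := by gcongr
          _ = s + 1 := one_mul _
    have h7 : 1 ≤ ε / 2 * p := by
      have : (M : ℝ) ≤ p := by exact_mod_cast (by omega : M ≤ p)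
      have := hM.trans this
      rw [div_le_iff₀ hε] at this
      linarith
    have h8 : q * ((α - ε) * p) ≤ q * (s - ε / 2 * p) := by
      gcongr
      linarith
    rw [hNr]
    linarith
  have hΛ : Lambda4 ((A : Set (ZMod N)).indicator 1) ≤ 1 / q := by
    refine lambda4_le_inv hN e A fun n d h0 h1 h2 h3 => ?_
    rw [hA, mem_quadraticSet] at h0 h1 h2 h3
    simp only [map_add, map_mul, map_ofNat, Prod.fst_add, Prod.snd_add, Prod.fst_mul,
      Prod.snd_mul, Prod.fst_ofNat, Prod.snd_ofNat] at h1 h2 h3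
    have hz := sub_eq_zero_of_val_lt hsK (hg0 _) (hgG _) (hg0 _) (hgG _) (hg0 _) (hgG _)
      (hg0 _) (hgG _) h0 h1 h2 h3
    obtain ⟨i1, i2⟩ := momentCode_eq_of_sub_eq (hidx0 _) (hidx _) (hidx0 _) (hidx _) (hidx0 _)
      (hidx _) (hidx0 _) (hidx _) hz
    obtain ⟨c1, b1⟩ := hidx_eq _ _ i1
    obtain ⟨c2, b2⟩ := hidx_eq _ _ i2
    exact eq_zero_of_symmetric_zmod hq hc c1 c2 b1 b2
  have hNN : N₀ ≤ N := by
    have : p ≤ p * q := Nat.le_mul_of_pos_right p (NeZero.pos q)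
    omega
  have := H N hNN A hunif hcard
  linarith

theorem mainTheorem4 (hcol : Symmetric4APColoringConjecture) :
    ∀ C : ℝ, 0 < C → ∃ α₀ : ℝ, 0 < α₀ ∧ ∀ α : ℝ, 0 < α → α < α₀ → rho4 α < α ^ C := by
  obtain ⟨e, he, hcol⟩ := hcol
  intro C hC
  -- With `w ≈ α^(-C)`, the exponent `1/(14C)` makes `r⁷` at most a constant times `α^(-1/2)`; then
  -- `αK ≤ B√α ≤ 1` once `α < B⁻²`.
  obtain ⟨Q, hQ⟩ := eventually_atTop.1 (he.eventually_le_const (show 0 < 1 / (14 * C) by positivity))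
  set B : ℝ := (16 * 73 * 4 ^ 7 + 4) * 8 ^ (1 / (2 * C)) with hB
  have hB0 : 0 < B := by positivity
  have lim : Tendsto (fun α : ℝ => α ^ (-C)) (𝓝[>] 0) atTop :=
    tendsto_rpow_neg_nhdsGT_zero (neg_neg_of_pos hC)
  obtain ⟨α₁, hα₁, hlarge⟩ := mem_nhdsGT_iff_exists_Ioo_subset.1 (lim.eventually_ge_atTop (Q : ℝ))
  refine ⟨min α₁ (min 1 ((B ^ 2)⁻¹)), lt_min hα₁ (by positivity), fun α hα hlt => ?_⟩
  have hlt1 : α < α₁ := hlt.trans_le (min_le_left _ _)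
  have hlt2 : α < 1 := hlt.trans_le ((min_le_right _ _).trans (min_le_left _ _))
  have hlt3 : α < (B ^ 2)⁻¹ := hlt.trans_le ((min_le_right _ _).trans (min_le_right _ _))
  have hQα : (Q : ℝ) ≤ α ^ (-C) := hlarge ⟨hα, hlt1⟩
  have hone : 1 ≤ α ^ (-C) := Real.one_le_rpow_of_pos_of_le_one_of_nonpos hα hlt2.le (by linarith)
  set w := ⌈α ^ (-C)⌉₊ with hw
  have hw1 : α ^ (-C) ≤ w := Nat.le_ceil _
  have hw2 : (w : ℝ) < α ^ (-C) + 1 := Nat.ceil_lt_add_one (by positivity)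
  have hw0 : 0 < w := by exact_mod_cast one_pos.trans_le (hone.trans hw1)
  have hQw : Q ≤ 4 * w := by
    have : Q ≤ w := by exact_mod_cast hQα.trans hw1
    omega
  obtain ⟨r, hr, hrcol⟩ := hcol (4 * w) (by omega)
  have hr0 : 1 ≤ r := by
    obtain ⟨c, -⟩ := hrcol
    have := (c 0).isLt
    omega
  have hr7 : (r : ℝ) ^ 7 ≤ 8 ^ (1 / (2 * C)) * α ^ (-(1 / 2) : ℝ) := by
    have h4w : (1 : ℝ) ≤ ((4 * w : ℕ) : ℝ) := by exact_mod_cast (by omega : 1 ≤ 4 * w)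
    have h8 : ((4 * w : ℕ) : ℝ) ≤ 8 * α ^ (-C) := by push_cast; linarith
    calc (r : ℝ) ^ 7 ≤ (((4 * w : ℕ) : ℝ) ^ (1 / (14 * C))) ^ 7 := by
          gcongr
          exact hr.trans (Real.rpow_le_rpow_of_exponent_le h4w (hQ _ hQw))
      _ = ((4 * w : ℕ) : ℝ) ^ (1 / (2 * C)) := by
          rw [← Real.rpow_natCast, ← Real.rpow_mul (by positivity)]
          congr 1
          field_simp
          norm_num
      _ ≤ (8 * α ^ (-C)) ^ (1 / (2 * C)) := by gcongr
      _ = 8 ^ (1 / (2 * C)) * α ^ (-(1 / 2) : ℝ) := by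
          rw [Real.mul_rpow (by positivity) (by positivity), ← Real.rpow_mul hα.le]
          congr 2
          field_simp
  have hαK : α * (16 * (73 * (4 * r) ^ 7) + 4) ≤ 1 := by
    have h1 : (1 : ℝ) ≤ (r : ℝ) ^ 7 := one_le_pow₀ (by exact_mod_cast hr0)
    have h2 : α * α ^ (-(1 / 2) : ℝ) = √α := by
      rw [Real.sqrt_eq_rpow]
      nth_rw 1 [← Real.rpow_one α]
      rw [← Real.rpow_add hα]
      norm_num
    have h3 : √α ≤ B⁻¹ := by
      refine Real.sqrt_le_iff.2 ⟨by positivity, ?_⟩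
      rw [inv_pow]; exact hlt3.le
    calc α * (16 * (73 * (4 * r) ^ 7) + 4) ≤ α * ((16 * 73 * 4 ^ 7 + 4) * (r : ℝ) ^ 7) := by
          gcongr; rw [mul_pow]; linarith
      _ ≤ α * ((16 * 73 * 4 ^ 7 + 4) * (8 ^ (1 / (2 * C)) * α ^ (-(1 / 2) : ℝ))) := by gcongr
      _ = B * (α * α ^ (-(1 / 2) : ℝ)) := by rw [hB]; ring
      _ = B * √α := by rw [h2]
      _ ≤ B * B⁻¹ := by gcongr
      _ = 1 := mul_inv_cancel₀ hB0.ne'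
  have hle : rho4 α ≤ 1 / ((4 * w : ℕ) : ℝ) :=
    csSup_le ⟨0, isLowerBound4AP_zero α⟩ fun ρ hρ => hρ.le_inv_of_hasColoring hw0 hrcol hαK
  refine hle.trans_lt ?_
  have hCpos : 0 < α ^ C := by positivity
  rw [Real.rpow_neg hα.le] at hw1 hone
  rw [div_lt_iff₀ (by push_cast; linarith)]
  have : 1 ≤ α ^ C * w := by
    calc (1 : ℝ) = α ^ C * (α ^ C)⁻¹ := (mul_inv_cancel₀ hCpos.ne').symm
      _ ≤ α ^ C * w := by gcongr
  push_cast
  linarith
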